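/- \textbf{Theorem (Lieb's theorem for the WVD-QOLCT).} Let $\mathbb H$ be the real quaternions with modulus $|\cdot|_Q$, let $|f|_{2,Q}=\left(\int_{\mathbb R^2}|f(x)|_Q^2\,dx\right)^{1/2}$, and let $L^2(\mathbb R^2,\mathbb H)$ be the space of measurable $f:\mathbb R^2\to\mathbb H$ with $|f|_{2,Q}<\infty$. For a quaternion $\nu$ with $\nu^2=-1$ and $A=(a,b,c,d,\tau,\eta)\in\mathbb R^6$ with $ad-bc=1$ and $b\neq 0$, put $$K_A^{\nu}(s,v)=\frac{1}{\sqrt{2\pi\nu b}}\;\exp\!\left(\nu\,\frac{a s^2-2s(v-\tau)-2v(d\tau-b\eta)+d(v^2+\tau^2)}{2b}\right),\qquad s,v\in\mathbb R,$$ where $\frac{1}{\sqrt{2\pi\nu b}}$ denotes $\frac{e^{-\operatorname{sgn}(b)\nu\pi/4}}{\sqrt{2\pi|b|}}$. Given quaternions $\lambda,\mu$ with $\lambda^2=\mu^2=-1$, parameters $A_l=(a_l,b_l,c_l,d_l,\tau_l,\eta_l)\in\mathbb R^6$ with $a_ld_l-b_lc_l=1$ and $b_l\ne0$ ($l=1,2$),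 and $f,g\in L^2(\mathbb R^2,\mathbb H)$, the Wigner--Ville distribution associated with the two-sided quaternionic offset linear canonical transform is $$\mathcal W_{f,g}^{A_1,A_2}(t,u)=\int_{\mathbb R^2}K_{A_1}^{\lambda}(s_1,u_1)\,f\!\left(t+\tfrac s2\right)\overline{g\!\left(t-\tfrac s2\right)}\,K_{A_2}^{\mu}(s_2,u_2)\,ds,\qquad t,u\in\mathbb R^2.$$ For every $2\le p<\infty$ there is a constant $C=C(p)>0$, depending only on $p$, such that for all such $\lambda,\mu,A_1,A_2$ and all $f,g\in L^2(\mathbb R^2,\mathbb H)$: the integral defining $\mathcal W_{f,g}^{A_1,A_2}(t,u)$ converges absolutely for all $t,u\in\mathbb R^2$, the function $(t,u)\mapsto|\mathcal W_{f,g}^{A_1,A_2}(t,u)|_Q^p$ is integrable on $\mathbb R^2\times\mathbb R^2$, and $$\int_{\mathbb R^2}\int_{\mathbb R^2}\left|\mathcal W_{f,g}^{A_1,A_2}(t,u)\right|_Q^p\,du\,dt\;\le\; C\,\frac{|b_1b_2|^{-\frac p2+1}}{(2\pi)^p}\,|f|_{2,Q}^p\,|g|_{2,Q}^p .$$ -/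

import Mathlib

open MeasureTheory
open scoped Quaternion

/-- The real parameters `a, b, c, d, τ, η` with `a d - b c = 1` of an offset linear canonical
transform in one variable. -/
structure OffsetMatrix where
  a : ℝ
  b : ℝ
  c : ℝ
  d : ℝ
  τ : ℝ
  η : ℝ
  det_eq_one : a * d - b * c = 1

/-- The one-variable kernel `K_A^ν(s, v)` of the offset linear canonical transform, for `b ≠ 0` and
a quaternion `ν` with `ν² = -1`. The factor `1 / √(ν 2π b)` is the principal value
`e^{-sgn(b) ν π/4} / √(2π|b|)`. -/
noncomputable def offsetKernel (ν : ℍ[ℝ]) (A : OffsetMatrix) (s v : ℝ) : ℍ[ℝ] :=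
  (1 / Real.sqrt (2 * Real.pi * |A.b|)) •
    (NormedSpace.exp ((-(SignType.sign A.b : ℝ) * (Real.pi / 4)) • ν) *
      NormedSpace.exp
        (((A.a * s ^ 2 - 2 * s * (v - A.τ) - 2 * v * (A.d * A.τ - A.b * A.η)
            + A.d * (v ^ 2 + A.τ ^ 2)) / (2 * A.b)) • ν))

/-- The function `s ↦ K_{A₁}^lam(s₁, u₁) f(t + s/2) conj(g(t - s/2)) K_{A₂}^mu(s₂, u₂)`. -/
noncomputable def wvdIntegrand (lam mu : ℍ[ℝ]) (A₁ A₂ : OffsetMatrix) (f g : ℝ × ℝ → ℍ[ℝ])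
    (t u s : ℝ × ℝ) : ℍ[ℝ] :=
  offsetKernel lam A₁ s.1 u.1 *
    (f (t + (1 / 2 : ℝ) • s) * star (g (t - (1 / 2 : ℝ) • s))) *
      offsetKernel mu A₂ s.2 u.2

/-- The Wigner-Ville distribution associated with the two-sided quaternionic offset linear
canonical transform, for `A₁.b ≠ 0` and `A₂.b ≠ 0`. -/
noncomputable def wvdQOLCT (lam mu : ℍ[ℝ]) (A₁ A₂ : OffsetMatrix) (f g : ℝ × ℝ → ℍ[ℝ])
    (t u : ℝ × ℝ) : ℍ[ℝ] :=
  ∫ s : ℝ × ℝ, wvdIntegrand lam mu A₁ A₂ f g t u s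

/-- The norm `|f|_{2,Q} = (∫ |f(x)|² dx)^{1/2}` of a square-integrable quaternion-valued signal. -/
noncomputable def quatL2Norm (f : ℝ × ℝ → ℍ[ℝ]) : ℝ :=
  Real.sqrt (∫ x : ℝ × ℝ, ‖f x‖ ^ 2)

/-!
Left multiplication by `lam` and right multiplication by `mu` are commuting real-linear maps of `ℍ`
with square `-1`. On the complexification of `ℍ` they are therefore simultaneously diagonalisable
with eigenvalues `±i`, and on a joint eigenspace the two kernels act as a scalar: a constant times
chirps in `s` and in `u` times the Fourier kernel in the rescaled variable `u / (2π b)`.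
Plancherel's theorem for vector-valued functions thus makes the two-sided transform an `L²`
isometry. Applied for fixed `t` to `s ↦ f (t + s/2) * star (g (t - s/2))`, this gives Moyal's
identity `∫∫ ‖W t u‖² du dt = ‖f‖² ‖g‖²`. Cauchy-Schwarz gives the uniform bound
`‖W t u‖ ≤ 4 ‖f‖ ‖g‖ / (2π √|b₁ b₂|)`, and `‖W‖ ^ p ≤ (sup ‖W‖) ^ (p - 2) * ‖W‖²` interpolates
between the two, with constant `C = 4 ^ (p - 2) * (2π)²`.
-/

section Plancherel

open FourierTransform SchwartzMap
open scoped ENNReal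

theorem eLpNorm_two_sq_eq_lintegral {α E : Type*} {m : MeasurableSpace α} [NormedAddCommGroup E]
    (f : α → E) (μ : Measure α) : eLpNorm f 2 μ ^ 2 = ∫⁻ x, ‖f x‖ₑ ^ 2 ∂μ := by
  simpa using eLpNorm_nnreal_pow_eq_lintegral (f := f) (μ := μ) (p := 2) two_ne_zero

theorem memLp_two_of_lintegral_lt_top {α E : Type*} {m : MeasurableSpace α} [NormedAddCommGroup E]
    {μ : Measure α} {f : α → E} (hf : AEStronglyMeasurable f μ)
    (hfin : ∫⁻ x, ‖f x‖ₑ ^ 2 ∂μ < ∞) : MemLp f 2 μ := by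
  rw [← eLpNorm_two_sq_eq_lintegral] at hfin
  exact ⟨hf, (ENNReal.pow_lt_top_iff.1 hfin).resolve_right two_ne_zero⟩

variable {V F : Type*} [NormedAddCommGroup V] [InnerProductSpace ℝ V] [FiniteDimensional ℝ V]
  [MeasurableSpace V] [BorelSpace V] [NormedAddCommGroup F] [InnerProductSpace ℂ F]
  [CompleteSpace F]

/-- Both sides define the same tempered distribution: move the Fourier transform to the test
function, for which the integral formula is available. -/
theorem fourier_toLp_ae_eq {φ : V → F} (h₁ : Integrable φ) (h₂ : MemLp φ 2) :
    (𝓕 (h₂.toLp φ) : Lp F 2 (volume : Measure V)) =ᵐ[volume] 𝓕 φ := by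
  have hcont : Continuous (𝓕 φ) :=
    VectorFourier.fourierIntegral_continuous Real.continuous_fourierChar continuous_inner h₁
  refine ae_eq_of_integral_contDiff_smul_eq
    ((Lp.memLp _).locallyIntegrable (by norm_num)) hcont.locallyIntegrable fun g hg hgc ↦ ?_
  let ψ : 𝓢(V, ℂ) := (hgc.comp_left (g := Complex.ofReal) (by simp)).toSchwartzMap
    (Complex.ofRealCLM.contDiff.comp hg)
  have hdistr := congrArg (fun T : 𝓢'(V, F) ↦ T ψ)
    (Lp.fourier_toTemperedDistribution_eq (h₂.toLp φ))
  simp only [TemperedDistribution.fourier_apply, Lp.toTemperedDistribution_apply] at hdistr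
  calc ∫ x, g x • (𝓕 (h₂.toLp φ) : Lp F 2 (volume : Measure V)) x
      = ∫ x, ψ x • (𝓕 (h₂.toLp φ) : Lp F 2 (volume : Measure V)) x := by
        congr with x
    _ = ∫ x, (𝓕 ψ) x • φ x := by
        rw [← hdistr]
        refine integral_congr_ae ?_
        filter_upwards [h₂.coeFn_toLp] with x hx
        rw [hx]
    _ = ∫ x, ψ x • 𝓕 φ x := by
        simpa [SchwartzMap.fourier_coe, Real.fourier_eq, VectorFourier.fourierIntegral] using
          VectorFourier.integral_fourierIntegral_smul_eq_flip (L := innerₗ V)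
          Real.continuous_fourierChar continuous_inner ψ.integrable h₁
    _ = ∫ x, g x • 𝓕 φ x := by
        congr with x

theorem eLpNorm_two_fourier {φ : V → F} (h₁ : Integrable φ) (h₂ : MemLp φ 2) :
    eLpNorm (𝓕 φ) 2 volume = eLpNorm φ 2 volume :=
  calc eLpNorm (𝓕 φ) 2 volume
      = ‖(𝓕 (h₂.toLp φ) : Lp F 2 (volume : Measure V))‖ₑ := by
        rw [Lp.enorm_def, eLpNorm_congr_ae (fourier_toLp_ae_eq h₁ h₂)]
    _ = ‖h₂.toLp φ‖ₑ := by rw [← ofReal_norm, Lp.norm_fourier_eq, ofReal_norm]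
    _ = eLpNorm φ 2 volume := Lp.enorm_toLp h₂

theorem lintegral_enorm_sq_fourier_prod {φ : ℝ × ℝ → F} (h₁ : Integrable φ) (h₂ : MemLp φ 2) :
    ∫⁻ w : ℝ × ℝ, ‖∫ s : ℝ × ℝ,
        Complex.exp ((-2 * Real.pi * (s.1 * w.1 + s.2 * w.2) : ℝ) * Complex.I) • φ s‖ₑ ^ 2
      = ∫⁻ s, ‖φ s‖ₑ ^ 2 := by
  let e := MeasurableEquiv.toLp 2 (ℝ × ℝ)
  have he : MeasurePreserving e := WithLp.volume_preserving_toLp ℝ ℝ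
  have he' : MeasurePreserving e.symm := WithLp.volume_preserving_ofLp ℝ ℝ
  have hPlancherel := congrArg (· ^ 2) (eLpNorm_two_fourier
    ((he'.integrable_comp_emb e.symm.measurableEmbedding).2 h₁) (h₂.comp_measurePreserving he'))
  simp only [eLpNorm_two_sq_eq_lintegral, ← he.lintegral_comp_emb e.measurableEmbedding]
    at hPlancherel
  refine Eq.trans (lintegral_congr fun w ↦ ?_) hPlancherel
  rw [Real.fourier_eq', ← he.integral_comp e.measurableEmbedding]
  congr 3 with s
  simp only [e, WithLp.prod_inner_apply, MeasurableEquiv.coe_toLp]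
  simp [mul_comm]

theorem map_prodMap_mul_left_volume {c₁ c₂ : ℝ} (h₁ : c₁ ≠ 0) (h₂ : c₂ ≠ 0) :
    Measure.map (Prod.map (c₁ * ·) (c₂ * ·)) (volume : Measure (ℝ × ℝ))
      = ENNReal.ofReal |(c₁ * c₂)⁻¹| • volume := by
  rw [Measure.volume_eq_prod, ← Measure.map_prod_map _ _ (by fun_prop) (by fun_prop),
    Real.map_volume_mul_left h₁, Real.map_volume_mul_left h₂, Measure.prod_smul_left,
    Measure.prod_smul_right, smul_smul, ← ENNReal.ofReal_mul (abs_nonneg _), ← abs_mul, mul_inv]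

/-- Substitute `w = (u₁ / (2π b₁), u₂ / (2π b₂))` in Plancherel's theorem. -/
theorem lintegral_enorm_sq_fourier_prod_div {b₁ b₂ : ℝ} (hb₁ : b₁ ≠ 0) (hb₂ : b₂ ≠ 0)
    {φ : ℝ × ℝ → F} (h₁ : Integrable φ) (h₂ : MemLp φ 2) :
    ∫⁻ u : ℝ × ℝ, ‖∫ s : ℝ × ℝ,
        Complex.exp ((-(s.1 * u.1 / b₁ + s.2 * u.2 / b₂) : ℝ) * Complex.I) • φ s‖ₑ ^ 2
      = ENNReal.ofReal ((2 * Real.pi) ^ 2 * |b₁ * b₂|) * ∫⁻ s, ‖φ s‖ₑ ^ 2 := by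
  have hc₁ : 2 * Real.pi * b₁ ≠ 0 := by positivity
  have hc₂ : 2 * Real.pi * b₂ ≠ 0 := by positivity
  let e : ℝ × ℝ ≃ᵐ ℝ × ℝ :=
    ((Homeomorph.mulLeft₀ _ hc₁).prodCongr (Homeomorph.mulLeft₀ _ hc₂)).toMeasurableEquiv
  have hmap : Measure.map e.symm volume
      = ENNReal.ofReal ((2 * Real.pi) ^ 2 * |b₁ * b₂|) • volume := by
    refine (map_prodMap_mul_left_volume (inv_ne_zero hc₁) (inv_ne_zero hc₂)).trans ?_
    rw [← mul_inv, inv_inv, show 2 * Real.pi * b₁ * (2 * Real.pi * b₂)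
      = (2 * Real.pi) ^ 2 * (b₁ * b₂) by ring, abs_mul, abs_of_nonneg (by positivity)]
  rw [← lintegral_enorm_sq_fourier_prod h₁ h₂, ← smul_eq_mul, ← lintegral_smul_measure, ← hmap,
    e.symm.measurableEmbedding.lintegral_map]
  refine lintegral_congr fun u ↦ ?_
  congr 3 with s
  congr 4
  change _ = -2 * Real.pi *
    (s.1 * ((2 * Real.pi * b₁)⁻¹ * u.1) + s.2 * ((2 * Real.pi * b₂)⁻¹ * u.2))
  field_simp

theorem lintegral_enorm_sq_fourier_prod_chirp {b₁ b₂ : ℝ} (hb₁ : b₁ ≠ 0) (hb₂ : b₂ ≠ 0)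
    (κ : ℝ × ℝ → ℝ) {χ : ℝ × ℝ → ℝ} (hχ : Continuous χ) {φ : ℝ × ℝ → F} (h₁ : Integrable φ)
    (h₂ : MemLp φ 2) :
    ∫⁻ u : ℝ × ℝ, ‖∫ s : ℝ × ℝ, Complex.exp
        ((κ u - (s.1 * u.1 / b₁ + s.2 * u.2 / b₂) + χ s : ℝ) * Complex.I) • φ s‖ₑ ^ 2
      = ENNReal.ofReal ((2 * Real.pi) ^ 2 * |b₁ * b₂|) * ∫⁻ s, ‖φ s‖ₑ ^ 2 := by
  let chirp : ℝ × ℝ → F := fun s ↦ Complex.exp (χ s * Complex.I) • φ s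
  have hnorm : ∀ s, ‖chirp s‖ = ‖φ s‖ := fun s ↦ by
    rw [norm_smul, Complex.norm_exp_ofReal_mul_I, one_mul]
  have henorm : ∀ s, ‖chirp s‖ₑ = ‖φ s‖ₑ := fun s ↦ enorm_eq_iff_norm_eq.2 (hnorm s)
  have hmeas : AEStronglyMeasurable chirp :=
    (by fun_prop : Continuous fun s ↦ Complex.exp (χ s * Complex.I)).aestronglyMeasurable.smul h₁.1
  have hchirp := lintegral_enorm_sq_fourier_prod_div hb₁ hb₂
    (h₁.congr' hmeas (.of_forall fun s ↦ (hnorm s).symm))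
    (h₂.congr_norm hmeas (.of_forall fun s ↦ (hnorm s).symm))
  simp only [henorm] at hchirp
  rw [← hchirp]
  refine lintegral_congr fun u ↦ ?_
  have hsplit : ∀ s : ℝ × ℝ, Complex.exp
      ((κ u - (s.1 * u.1 / b₁ + s.2 * u.2 / b₂) + χ s : ℝ) * Complex.I) • φ s
      = Complex.exp (κ u * Complex.I) •
        Complex.exp ((-(s.1 * u.1 / b₁ + s.2 * u.2 / b₂) : ℝ) * Complex.I) • chirp s := by
    intro s
    simp only [chirp, smul_smul, ← Complex.exp_add, ← add_mul, ← Complex.ofReal_add]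
    ring_nf
  simp only [hsplit, integral_smul, enorm_smul]
  rw [← ofReal_norm (Complex.exp _), Complex.norm_exp_ofReal_mul_I, ENNReal.ofReal_one, one_mul]

end Plancherel

section ImaginaryUnit

variable {ν : ℍ[ℝ]}

theorem quaternion_norm_eq_one_of_sq_eq_neg_one (h : ν ^ 2 = -1) : ‖ν‖ = 1 := by
  rw [← pow_eq_one_iff_of_nonneg (norm_nonneg ν) two_ne_zero, ← norm_pow, h, norm_neg, norm_one]

theorem quaternion_re_eq_zero_of_sq_eq_neg_one (h : ν ^ 2 = -1) : ν.re = 0 := by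
  rw [← Quaternion.sq_eq_neg_normSq, Quaternion.normSq_eq_norm_mul_self,
    quaternion_norm_eq_one_of_sq_eq_neg_one h, mul_one, Quaternion.coe_one, h]

theorem quaternion_exp_smul (h : ν ^ 2 = -1) (θ : ℝ) :
    NormedSpace.exp (θ • ν) = (Real.cos θ : ℍ[ℝ]) + Real.sin θ • ν := by
  have hre : (θ • ν).re = 0 := by
    rw [Quaternion.re_smul, quaternion_re_eq_zero_of_sq_eq_neg_one h, smul_zero]
  have hsin : Real.sin |θ| / |θ| * θ = Real.sin θ := by
    rcases eq_or_ne θ 0 with rfl | hθ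
    · simp
    · rcases abs_choice θ with habs | habs <;> rw [habs]
      · exact div_mul_cancel₀ _ hθ
      · rw [Real.sin_neg, neg_div_neg_eq, div_mul_cancel₀ _ hθ]
  rw [Quaternion.exp_of_re_eq_zero _ hre, norm_smul, quaternion_norm_eq_one_of_sq_eq_neg_one h,
    mul_one, Real.norm_eq_abs, Real.cos_abs, smul_smul, hsin]

theorem quaternion_norm_exp_smul (h : ν ^ 2 = -1) (θ : ℝ) : ‖NormedSpace.exp (θ • ν)‖ = 1 := by
  rw [Quaternion.norm_exp, Quaternion.re_smul, quaternion_re_eq_zero_of_sq_eq_neg_one h, smul_zero,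
    NormedSpace.exp_zero, norm_one]

end ImaginaryUnit

section EigenCoord

/-- The coordinatewise inclusion of `ℍ` into its complexification `ℂ⁴`. -/
noncomputable def quaternionComplexify : ℍ[ℝ] →L[ℝ] EuclideanSpace ℂ (Fin 4) :=
  LinearMap.toContinuousLinearMap
    { toFun q := !₂[(q.re : ℂ), (q.imI : ℂ), (q.imJ : ℂ), (q.imK : ℂ)]
      map_add' p q := by ext i; fin_cases i <;> simp
      map_smul' r q := by ext i; fin_cases i <;> simp }

theorem norm_sq_quaternionComplexify_sub_I_smul (p q : ℍ[ℝ]) :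
    ‖quaternionComplexify p - Complex.I • quaternionComplexify q‖ ^ 2 = ‖p‖ ^ 2 + ‖q‖ ^ 2 := by
  have hnorm (x y : ℝ) : ‖(x - Complex.I * y : ℂ)‖ ^ 2 = x ^ 2 + y ^ 2 := by
    rw [← Complex.normSq_eq_norm_sq]
    simp [Complex.normSq_apply, sq]
  have hnorm_sq (q : ℍ[ℝ]) : ‖q‖ ^ 2 = q.re ^ 2 + q.imI ^ 2 + q.imJ ^ 2 + q.imK ^ 2 := by
    rw [sq, ← Quaternion.normSq_eq_norm_mul_self, Quaternion.normSq_def']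
  calc ‖quaternionComplexify p - Complex.I • quaternionComplexify q‖ ^ 2
      = (p.re ^ 2 + q.re ^ 2) + (p.imI ^ 2 + q.imI ^ 2) + (p.imJ ^ 2 + q.imJ ^ 2)
          + (p.imK ^ 2 + q.imK ^ 2) := by
        rw [EuclideanSpace.norm_sq_eq, Fin.sum_univ_four]
        simp only [← hnorm]
        rfl
    _ = ‖p‖ ^ 2 + ‖q‖ ^ 2 := by
        rw [hnorm_sq, hnorm_sq]
        ring

/-- Left multiplication by `lam` and right multiplication by `mu` commute and square to `-1`, so
they are simultaneously diagonalisable on the complexification of `ℍ`. This is (a multiple of) the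
projection onto the joint eigenspace on which both act as `i`. -/
noncomputable def eigenCoord (lam mu : ℍ[ℝ]) : ℍ[ℝ] →L[ℝ] EuclideanSpace ℂ (Fin 4) :=
  LinearMap.toContinuousLinearMap
    { toFun q := quaternionComplexify (q - lam * q * mu) -
        Complex.I • quaternionComplexify (lam * (q - lam * q * mu))
      map_add' p q := by
        simp only [mul_add, add_mul, add_sub_add_comm, map_add, smul_add]
      map_smul' r q := by
        simp only [mul_smul_comm, smul_mul_assoc, ← smul_sub, map_smul, smul_comm Complex.I,
          RingHom.id_apply] }

variable {lam mu : ℍ[ℝ]}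

theorem eigenCoord_apply (lam mu q : ℍ[ℝ]) :
    eigenCoord lam mu q = quaternionComplexify (q - lam * q * mu) -
      Complex.I • quaternionComplexify (lam * (q - lam * q * mu)) := rfl

theorem eigenCoord_mul_left (hlam : lam ^ 2 = -1) (mu q : ℍ[ℝ]) :
    eigenCoord lam mu (lam * q) = Complex.I • eigenCoord lam mu q := by
  have hcomm : lam * q - lam * (lam * q) * mu = lam * (q - lam * q * mu) := by
    simp only [mul_sub, mul_assoc]
  have hinv (p : ℍ[ℝ]) : lam * (lam * p) = -p := by rw [← mul_assoc, ← sq, hlam, neg_one_mul]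
  rw [eigenCoord_apply, eigenCoord_apply, hcomm, hinv, map_neg, smul_neg, smul_sub, smul_smul,
    Complex.I_mul_I, neg_one_smul]
  abel

theorem eigenCoord_mul_right (hlam : lam ^ 2 = -1) (hmu : mu ^ 2 = -1) (q : ℍ[ℝ]) :
    eigenCoord lam mu (q * mu) = Complex.I • eigenCoord lam mu q := by
  have hcomm : q * mu - lam * (q * mu) * mu = lam * q - lam * (lam * q) * mu := by
    have hl : lam * (lam * q) = -q := by rw [← mul_assoc, ← sq, hlam, neg_one_mul]
    have hm : lam * (q * mu) * mu = -(lam * q) := by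
      rw [mul_assoc, mul_assoc, ← sq, hmu, mul_neg_one, mul_neg]
    rw [hl, hm, neg_mul]
    abel
  rw [← eigenCoord_mul_left hlam, eigenCoord_apply, eigenCoord_apply, hcomm]

theorem eigenCoord_exp_mul_mul_exp (hlam : lam ^ 2 = -1) (hmu : mu ^ 2 = -1) (α β : ℝ)
    (q : ℍ[ℝ]) :
    eigenCoord lam mu (NormedSpace.exp (α • lam) * q * NormedSpace.exp (β • mu))
      = Complex.exp ((α + β : ℝ) * Complex.I) • eigenCoord lam mu q := by
  have hleft (θ : ℝ) (x : ℍ[ℝ]) : eigenCoord lam mu (NormedSpace.exp (θ • lam) * x)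
      = Complex.exp (θ * Complex.I) • eigenCoord lam mu x := by
    rw [quaternion_exp_smul hlam, add_mul, Quaternion.coe_mul_eq_smul, smul_mul_assoc, map_add,
      map_smul, map_smul, eigenCoord_mul_left hlam, Complex.exp_mul_I, add_smul, mul_smul,
      ← Complex.ofReal_cos, ← Complex.ofReal_sin, Complex.coe_smul, Complex.coe_smul]
  have hright (θ : ℝ) (x : ℍ[ℝ]) : eigenCoord lam mu (x * NormedSpace.exp (θ • mu))
      = Complex.exp (θ * Complex.I) • eigenCoord lam mu x := by
    rw [quaternion_exp_smul hmu, mul_add, Quaternion.mul_coe_eq_smul, mul_smul_comm, map_add,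
      map_smul, map_smul, eigenCoord_mul_right hlam hmu, Complex.exp_mul_I, add_smul, mul_smul,
      ← Complex.ofReal_cos, ← Complex.ofReal_sin, Complex.coe_smul, Complex.coe_smul]
  rw [hright, hleft, smul_smul, ← Complex.exp_add, ← add_mul, ← Complex.ofReal_add, add_comm α]

theorem norm_sq_eigenCoord (hlam : lam ^ 2 = -1) (mu q : ℍ[ℝ]) :
    ‖eigenCoord lam mu q‖ ^ 2 = 2 * ‖q - lam * q * mu‖ ^ 2 := by
  rw [eigenCoord_apply, norm_sq_quaternionComplexify_sub_I_smul, norm_mul,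
    quaternion_norm_eq_one_of_sq_eq_neg_one hlam, one_mul, two_mul]

theorem norm_sq_eigenCoord_add_neg (hlam : lam ^ 2 = -1) (hmu : mu ^ 2 = -1) (q : ℍ[ℝ]) :
    ‖eigenCoord lam mu q‖ ^ 2 + ‖eigenCoord lam (-mu) q‖ ^ 2 = 8 * ‖q‖ ^ 2 := by
  have hpar := parallelogram_law_with_norm ℝ q (lam * q * mu)
  rw [norm_mul, norm_mul, quaternion_norm_eq_one_of_sq_eq_neg_one hlam,
    quaternion_norm_eq_one_of_sq_eq_neg_one hmu, one_mul, mul_one] at hpar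
  rw [norm_sq_eigenCoord hlam, norm_sq_eigenCoord hlam, mul_neg, sub_neg_eq_add]
  linear_combination 2 * hpar

theorem enorm_sq_eigenCoord_add_neg (hlam : lam ^ 2 = -1) (hmu : mu ^ 2 = -1) (q : ℍ[ℝ]) :
    ‖eigenCoord lam mu q‖ₑ ^ 2 + ‖eigenCoord lam (-mu) q‖ₑ ^ 2 = 8 * ‖q‖ₑ ^ 2 := by
  simp only [← ofReal_norm, ← ENNReal.ofReal_pow (norm_nonneg _)]
  rw [← ENNReal.ofReal_add (by positivity) (by positivity), norm_sq_eigenCoord_add_neg hlam hmu,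
    ENNReal.ofReal_mul (by norm_num), ENNReal.ofReal_ofNat]

theorem lintegral_enorm_sq_eigenCoord_add_neg {α : Type*} {m : MeasurableSpace α} {ρ : Measure α}
    (hlam : lam ^ 2 = -1) (hmu : mu ^ 2 = -1) {k : α → ℍ[ℝ]} (hk : AEStronglyMeasurable k ρ) :
    ∫⁻ x, ‖eigenCoord lam mu (k x)‖ₑ ^ 2 ∂ρ + ∫⁻ x, ‖eigenCoord lam (-mu) (k x)‖ₑ ^ 2 ∂ρ
      = 8 * ∫⁻ x, ‖k x‖ₑ ^ 2 ∂ρ := by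
  rw [← lintegral_add_left'
    (((eigenCoord lam mu).continuous.comp_aestronglyMeasurable hk).enorm.pow_const 2),
    ← lintegral_const_mul' _ _ (by norm_num)]
  simp only [enorm_sq_eigenCoord_add_neg hlam hmu]

end EigenCoord

section OffsetKernel

/-- The real phase of the offset linear canonical kernel, including the constant `-sgn(b) π/4`
coming from its complex square root. -/
noncomputable def offsetPhase (A : OffsetMatrix) (s v : ℝ) : ℝ :=
  -(SignType.sign A.b : ℝ) * (Real.pi / 4) +
    (A.a * s ^ 2 - 2 * s * (v - A.τ) - 2 * v * (A.d * A.τ - A.b * A.η)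
      + A.d * (v ^ 2 + A.τ ^ 2)) / (2 * A.b)

@[fun_prop]
theorem continuous_offsetPhase (A : OffsetMatrix) :
    Continuous fun x : ℝ × ℝ ↦ offsetPhase A x.1 x.2 := by
  unfold offsetPhase
  fun_prop

theorem exists_offsetPhase_eq (A : OffsetMatrix) :
    ∃ κ χ : ℝ → ℝ, Continuous χ ∧ ∀ s v, offsetPhase A s v = κ v - s * v / A.b + χ s := by
  refine ⟨fun v ↦ -(SignType.sign A.b : ℝ) * (Real.pi / 4) +
      (A.d * v ^ 2 - 2 * v * (A.d * A.τ - A.b * A.η) + A.d * A.τ ^ 2) / (2 * A.b),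
    fun s ↦ (A.a * s ^ 2 + 2 * s * A.τ) / (2 * A.b), by fun_prop, fun s v ↦ ?_⟩
  unfold offsetPhase
  ring

theorem offsetKernel_eq_smul_exp (ν : ℍ[ℝ]) (A : OffsetMatrix) (s v : ℝ) :
    offsetKernel ν A s v
      = (1 / √(2 * Real.pi * |A.b|)) • NormedSpace.exp (offsetPhase A s v • ν) := by
  let +nondep : NormedAlgebra ℚ ℍ[ℝ] := .restrictScalars ℚ ℝ ℍ[ℝ]
  rw [offsetKernel, offsetPhase, add_smul,
    NormedSpace.exp_add_of_commute (((Commute.refl ν).smul_left _).smul_right _)]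

@[fun_prop]
theorem continuous_offsetKernel (ν : ℍ[ℝ]) (A : OffsetMatrix) :
    Continuous fun x : ℝ × ℝ ↦ offsetKernel ν A x.1 x.2 := by
  let +nondep : NormedAlgebra ℚ ℍ[ℝ] := .restrictScalars ℚ ℝ ℍ[ℝ]
  simp only [offsetKernel_eq_smul_exp]
  have hphase : Continuous fun x : ℝ × ℝ ↦ offsetPhase A x.1 x.2 • ν := by fun_prop
  exact (NormedSpace.exp_continuous.comp hphase).const_smul (1 / √(2 * Real.pi * |A.b|))

theorem norm_offsetKernel {ν : ℍ[ℝ]} (hν : ν ^ 2 = -1) (A : OffsetMatrix) (s v : ℝ) :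
    ‖offsetKernel ν A s v‖ = 1 / √(2 * Real.pi * |A.b|) := by
  rw [offsetKernel_eq_smul_exp, norm_smul, quaternion_norm_exp_smul hν, mul_one,
    Real.norm_of_nonneg (by positivity)]

/-- Complex conjugation of the kernel: replacing the imaginary unit `ν` by `-ν` amounts to this
change of parameters. -/
def OffsetMatrix.conj (A : OffsetMatrix) : OffsetMatrix where
  a := A.a
  b := -A.b
  c := -A.c
  d := A.d
  τ := A.τ
  η := -A.η
  det_eq_one := by rw [neg_mul_neg, A.det_eq_one]

theorem offsetPhase_conj (A : OffsetMatrix) (s v : ℝ) :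
    offsetPhase A.conj s v = -offsetPhase A s v := by
  simp only [offsetPhase, OffsetMatrix.conj, Left.sign_neg, SignType.coe_neg]
  ring

theorem offsetKernel_neg_conj (ν : ℍ[ℝ]) (A : OffsetMatrix) (s v : ℝ) :
    offsetKernel (-ν) A.conj s v = offsetKernel ν A s v := by
  rw [offsetKernel_eq_smul_exp, offsetKernel_eq_smul_exp, offsetPhase_conj, neg_smul_neg,
    OffsetMatrix.conj, abs_neg]

end OffsetKernel

section TwoSidedQOLCT

/-- The two-sided quaternionic offset linear canonical transform of `k`. -/
noncomputable def twoSidedQOLCT (lam mu : ℍ[ℝ]) (A₁ A₂ : OffsetMatrix) (k : ℝ × ℝ → ℍ[ℝ])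
    (u : ℝ × ℝ) : ℍ[ℝ] :=
  ∫ s : ℝ × ℝ, offsetKernel lam A₁ s.1 u.1 * k s * offsetKernel mu A₂ s.2 u.2

variable {lam mu : ℍ[ℝ]} {A₁ A₂ : OffsetMatrix} {k : ℝ × ℝ → ℍ[ℝ]}

theorem twoSidedQOLCT_neg_conj (lam mu : ℍ[ℝ]) (A₁ A₂ : OffsetMatrix) (k : ℝ × ℝ → ℍ[ℝ]) :
    twoSidedQOLCT lam (-mu) A₁ A₂.conj k = twoSidedQOLCT lam mu A₁ A₂ k := by
  funext u
  simp only [twoSidedQOLCT, offsetKernel_neg_conj]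

theorem inv_sqrt_two_pi_mul_inv_sqrt_two_pi (x y : ℝ) :
    1 / √(2 * Real.pi * |x|) * (1 / √(2 * Real.pi * |y|)) = 1 / (2 * Real.pi * √|x * y|) := by
  rw [div_mul_div_comm, one_mul, ← Real.sqrt_mul (by positivity), mul_mul_mul_comm, ← sq, ← abs_mul,
    Real.sqrt_mul (by positivity), Real.sqrt_sq (by positivity)]

theorem norm_offsetKernel_mul_mul (hlam : lam ^ 2 = -1) (hmu : mu ^ 2 = -1) (s u : ℝ × ℝ)
    (q : ℍ[ℝ]) :
    ‖offsetKernel lam A₁ s.1 u.1 * q * offsetKernel mu A₂ s.2 u.2‖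
      = 1 / (2 * Real.pi * √|A₁.b * A₂.b|) * ‖q‖ := by
  rw [norm_mul, norm_mul, norm_offsetKernel hlam, norm_offsetKernel hmu, mul_right_comm,
    inv_sqrt_two_pi_mul_inv_sqrt_two_pi]

theorem integrable_twoSidedQOLCT_integrand (hlam : lam ^ 2 = -1) (hmu : mu ^ 2 = -1)
    (hk : Integrable k) (u : ℝ × ℝ) :
    Integrable fun s : ℝ × ℝ ↦ offsetKernel lam A₁ s.1 u.1 * k s * offsetKernel mu A₂ s.2 u.2 := by
  have hK₁ : Continuous fun s : ℝ × ℝ ↦ offsetKernel lam A₁ s.1 u.1 := by fun_prop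
  have hK₂ : Continuous fun s : ℝ × ℝ ↦ offsetKernel mu A₂ s.2 u.2 := by fun_prop
  refine (hk.norm.const_mul (1 / (2 * Real.pi * √|A₁.b * A₂.b|))).mono' ?_
    (.of_forall fun s ↦ (norm_offsetKernel_mul_mul hlam hmu s u (k s)).le)
  exact (hK₁.aestronglyMeasurable.mul hk.1).mul hK₂.aestronglyMeasurable

theorem continuous_twoSidedQOLCT (hlam : lam ^ 2 = -1) (hmu : mu ^ 2 = -1) (hk : Integrable k) :
    Continuous (twoSidedQOLCT lam mu A₁ A₂ k) := by
  refine continuous_of_dominated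
    (fun u ↦ (integrable_twoSidedQOLCT_integrand hlam hmu hk u).1)
    (fun u ↦ .of_forall fun s ↦ (norm_offsetKernel_mul_mul hlam hmu s u (k s)).le)
    (hk.norm.const_mul _) (.of_forall fun s ↦ ?_)
  have hK₁ : Continuous fun u : ℝ × ℝ ↦ offsetKernel lam A₁ s.1 u.1 := by fun_prop
  have hK₂ : Continuous fun u : ℝ × ℝ ↦ offsetKernel mu A₂ s.2 u.2 := by fun_prop
  exact (hK₁.mul continuous_const).mul hK₂

theorem aestronglyMeasurable_twoSidedQOLCT {X : Type*} [MeasurableSpace X] {ρ : Measure X}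
    [SFinite ρ] (lam mu : ℍ[ℝ]) (A₁ A₂ : OffsetMatrix) {k : X → ℝ × ℝ → ℍ[ℝ]}
    (hk : AEStronglyMeasurable (fun z : X × (ℝ × ℝ) ↦ k z.1 z.2) (ρ.prod volume)) :
    AEStronglyMeasurable (fun z : X × (ℝ × ℝ) ↦ twoSidedQOLCT lam mu A₁ A₂ (k z.1) z.2)
      (ρ.prod volume) := by
  have hK (ν : ℍ[ℝ]) (A : OffsetMatrix) {φ : (X × (ℝ × ℝ)) × (ℝ × ℝ) → ℝ × ℝ}
      (hφ : Measurable φ) : AEStronglyMeasurable (fun w ↦ offsetKernel ν A (φ w).1 (φ w).2)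
        ((ρ.prod volume).prod volume) :=
    ((continuous_offsetKernel ν A).stronglyMeasurable.comp_measurable hφ).aestronglyMeasurable
  have hK₁ := hK lam A₁ (φ := fun w ↦ (w.2.1, w.1.2.1)) (by fun_prop)
  have hK₂ := hK mu A₂ (φ := fun w ↦ (w.2.2, w.1.2.2)) (by fun_prop)
  have hproj : Measure.QuasiMeasurePreserving
      (Prod.map Prod.fst id : (X × (ℝ × ℝ)) × (ℝ × ℝ) → X × (ℝ × ℝ))
      ((ρ.prod volume).prod volume) (ρ.prod volume) :=
    QuasiMeasurePreserving.prodMap Measure.quasiMeasurePreserving_fst (.id volume)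
  exact ((hK₁.mul (hk.comp_quasiMeasurePreserving hproj)).mul hK₂).integral_prod_right'

theorem norm_twoSidedQOLCT_le (hlam : lam ^ 2 = -1) (hmu : mu ^ 2 = -1) (k : ℝ × ℝ → ℍ[ℝ])
    (u : ℝ × ℝ) :
    ‖twoSidedQOLCT lam mu A₁ A₂ k u‖ ≤ 1 / (2 * Real.pi * √|A₁.b * A₂.b|) * ∫ s, ‖k s‖ := by
  refine (norm_integral_le_integral_norm _).trans_eq ?_
  simp only [norm_offsetKernel_mul_mul hlam hmu, integral_const_mul]

theorem eigenCoord_offsetKernel_mul_mul (hlam : lam ^ 2 = -1) (hmu : mu ^ 2 = -1) (s u : ℝ × ℝ)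
    (q : ℍ[ℝ]) :
    eigenCoord lam mu (offsetKernel lam A₁ s.1 u.1 * q * offsetKernel mu A₂ s.2 u.2)
      = (1 / (2 * Real.pi * √|A₁.b * A₂.b|)) • Complex.exp
        ((offsetPhase A₁ s.1 u.1 + offsetPhase A₂ s.2 u.2 : ℝ) * Complex.I) •
          eigenCoord lam mu q := by
  simp only [offsetKernel_eq_smul_exp, smul_mul_assoc, mul_smul_comm, map_smul,
    eigenCoord_exp_mul_mul_exp hlam hmu]
  rw [smul_smul, mul_comm, inv_sqrt_two_pi_mul_inv_sqrt_two_pi]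

theorem lintegral_enorm_sq_eigenCoord_twoSidedQOLCT (hlam : lam ^ 2 = -1) (hmu : mu ^ 2 = -1)
    (h₁ : A₁.b ≠ 0) (h₂ : A₂.b ≠ 0) (hk : Integrable k) (hk₂ : MemLp k 2) :
    ∫⁻ u, ‖eigenCoord lam mu (twoSidedQOLCT lam mu A₁ A₂ k u)‖ₑ ^ 2
      = ∫⁻ s, ‖eigenCoord lam mu (k s)‖ₑ ^ 2 := by
  obtain ⟨κ₁, χ₁, hχ₁, hphase₁⟩ := exists_offsetPhase_eq A₁
  obtain ⟨κ₂, χ₂, hχ₂, hphase₂⟩ := exists_offsetPhase_eq A₂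
  have hphase (s u : ℝ × ℝ) : offsetPhase A₁ s.1 u.1 + offsetPhase A₂ s.2 u.2
      = κ₁ u.1 + κ₂ u.2 - (s.1 * u.1 / A₁.b + s.2 * u.2 / A₂.b) + (χ₁ s.1 + χ₂ s.2) := by
    rw [hphase₁, hphase₂]
    ring
  have hconst : ‖1 / (2 * Real.pi * √|A₁.b * A₂.b|)‖ₑ ^ 2
      * ENNReal.ofReal ((2 * Real.pi) ^ 2 * |A₁.b * A₂.b|) = 1 := by
    have hb : 0 < |A₁.b * A₂.b| := abs_pos.2 (mul_ne_zero h₁ h₂)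
    rw [Real.enorm_of_nonneg (by positivity), ← ENNReal.ofReal_pow (by positivity),
      ← ENNReal.ofReal_mul (by positivity), div_pow, mul_pow, Real.sq_sqrt hb.le, one_pow,
      one_div_mul_cancel (by positivity), ENNReal.ofReal_one]
  have hpull (u : ℝ × ℝ) := (eigenCoord lam mu).integral_comp_comm
    (integrable_twoSidedQOLCT_integrand (A₁ := A₁) (A₂ := A₂) hlam hmu hk u)
  simp only [twoSidedQOLCT, ← hpull, eigenCoord_offsetKernel_mul_mul hlam hmu, integral_smul,
    enorm_smul, mul_pow, hphase]
  rw [lintegral_const_mul' _ _ (by finiteness), lintegral_enorm_sq_fourier_prod_chirp h₁ h₂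
    (fun u ↦ κ₁ u.1 + κ₂ u.2) (χ := fun s ↦ χ₁ s.1 + χ₂ s.2) (by fun_prop)
    ((eigenCoord lam mu).integrable_comp hk) ((eigenCoord lam mu).comp_memLp' hk₂),
    ← mul_assoc, hconst, one_mul]

theorem lintegral_enorm_sq_twoSidedQOLCT (hlam : lam ^ 2 = -1) (hmu : mu ^ 2 = -1)
    (h₁ : A₁.b ≠ 0) (h₂ : A₂.b ≠ 0) (hk : Integrable k) (hk₂ : MemLp k 2) :
    ∫⁻ u, ‖twoSidedQOLCT lam mu A₁ A₂ k u‖ₑ ^ 2 = ∫⁻ s, ‖k s‖ₑ ^ 2 := by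
  have hpos := lintegral_enorm_sq_eigenCoord_twoSidedQOLCT hlam hmu h₁ h₂ hk hk₂
  have hneg := lintegral_enorm_sq_eigenCoord_twoSidedQOLCT (A₂ := A₂.conj) hlam
    ((neg_sq mu).trans hmu) h₁ (neg_ne_zero.2 h₂) hk hk₂
  rw [twoSidedQOLCT_neg_conj] at hneg
  rw [← ENNReal.mul_right_inj (a := 8) (by norm_num) (by norm_num)]
  calc 8 * ∫⁻ u, ‖twoSidedQOLCT lam mu A₁ A₂ k u‖ₑ ^ 2
      = (∫⁻ u, ‖eigenCoord lam mu (twoSidedQOLCT lam mu A₁ A₂ k u)‖ₑ ^ 2)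
          + ∫⁻ u, ‖eigenCoord lam (-mu) (twoSidedQOLCT lam mu A₁ A₂ k u)‖ₑ ^ 2 := by
        rw [← lintegral_enorm_sq_eigenCoord_add_neg hlam hmu
          (continuous_twoSidedQOLCT hlam hmu hk).aestronglyMeasurable]
    _ = 8 * ∫⁻ s, ‖k s‖ₑ ^ 2 := by
        rw [hpos, hneg, lintegral_enorm_sq_eigenCoord_add_neg hlam hmu hk.1]

end TwoSidedQOLCT

section InstantaneousCorrelation

open scoped ENNReal

/-- The instantaneous cross-correlation of two signals at time `t`, whose transform in the lag `s`
is the Wigner-Ville distribution. -/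
noncomputable def instantaneousCorr {E R : Type*} [AddCommGroup E] [Module ℝ E] [Mul R]
    [Star R] (f g : E → R) (t s : E) : R :=
  f (t + (1 / 2 : ℝ) • s) * star (g (t - (1 / 2 : ℝ) • s))

theorem instantaneousCorr_eq_mul_star {E R : Type*} [AddCommGroup E] [Module ℝ E] [Mul R]
    [Star R] (f g : E → R) (t s : E) :
    instantaneousCorr f g t s = f (t + (1 / 2 : ℝ) • s) * star (g (t + (-(1 / 2) : ℝ) • s)) := by
  rw [instantaneousCorr, neg_smul, sub_eq_add_neg]

variable {E : Type*} [NormedAddCommGroup E] [NormedSpace ℝ E] [MeasurableSpace E] [BorelSpace E]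

theorem measurableEmbedding_add_smul (t : E) {c : ℝ} (hc : c ≠ 0) :
    MeasurableEmbedding fun s : E ↦ t + c • s :=
  ((Homeomorph.smulOfNeZero c hc).trans (Homeomorph.addLeft t)).measurableEmbedding

variable [FiniteDimensional ℝ E] {ρ : Measure E} [ρ.IsAddHaarMeasure]

variable (ρ) in
theorem map_add_smul_addHaar (t : E) {c : ℝ} (hc : c ≠ 0) :
    Measure.map (fun s ↦ t + c • s) ρ
      = ENNReal.ofReal |(c ^ Module.finrank ℝ E)⁻¹| • ρ := by
  rw [show (fun s ↦ t + c • s) = (t + ·) ∘ (c • ·) from rfl,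
    ← Measure.map_map (by fun_prop) (by fun_prop), Measure.map_addHaar_smul ρ hc,
    Measure.map_smul, map_add_left_eq_self]

theorem memLp_comp_add_smul {F : Type*} [NormedAddCommGroup F] {f : E → F} {p : ℝ≥0∞}
    (hf : MemLp f p ρ) (t : E) {c : ℝ} (hc : c ≠ 0) : MemLp (fun s ↦ f (t + c • s)) p ρ := by
  refine (measurableEmbedding_add_smul t hc).memLp_map_measure_iff.1 ?_
  rw [map_add_smul_addHaar ρ t hc]
  exact hf.smul_measure ENNReal.ofReal_ne_top

theorem eLpNorm_comp_add_smul {F : Type*} [NormedAddCommGroup F] (f : E → F) (p : ℝ≥0∞) (t : E)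
    {c : ℝ} (hc : c ≠ 0) :
    eLpNorm (fun s ↦ f (t + c • s)) p ρ
      = ENNReal.ofReal |(c ^ Module.finrank ℝ E)⁻¹| ^ (1 / p).toReal * eLpNorm f p ρ := by
  refine ((measurableEmbedding_add_smul t hc).eLpNorm_map_measure (g := f)).symm.trans ?_
  rw [map_add_smul_addHaar ρ t hc, eLpNorm_smul_measure_of_ne_zero (by positivity), smul_eq_mul]

variable (ρ) in
theorem quasiMeasurePreserving_add_smul (c : ℝ) :
    Measure.QuasiMeasurePreserving (fun z : E × E ↦ z.1 + c • z.2) (ρ.prod ρ) ρ :=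
  QuasiMeasurePreserving.prod_of_left (by fun_prop) (.of_forall fun s ↦
    (measurePreserving_add_right ρ (c • s)).quasiMeasurePreserving)

variable {R : Type*} [NormedRing R] [StarRing R] [NormedStarGroup R] {f g : E → R}

theorem integrable_instantaneousCorr (hf : MemLp f 2 ρ) (hg : MemLp g 2 ρ) (t : E) :
    Integrable (instantaneousCorr f g t) ρ := by
  simp only [funext (instantaneousCorr_eq_mul_star f g t)]
  exact (memLp_comp_add_smul hf t (by norm_num)).integrable_mul
    (memLp_comp_add_smul hg t (by norm_num)).star

theorem eLpNorm_one_instantaneousCorr_le (hf : MemLp f 2 ρ) (hg : MemLp g 2 ρ) (t : E) :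
    eLpNorm (instantaneousCorr f g t) 1 ρ
      ≤ 2 ^ Module.finrank ℝ E * (eLpNorm f 2 ρ * eLpNorm g 2 ρ) := by
  have hhalf : (1 / 2 : ℝ) ≠ 0 := by norm_num
  have hneg : (-(1 / 2) : ℝ) ≠ 0 := by norm_num
  have hscale {c : ℝ} (hc : |c| = 1 / 2) :
      ENNReal.ofReal |(c ^ Module.finrank ℝ E)⁻¹| = 2 ^ Module.finrank ℝ E := by
    rw [abs_inv, abs_pow, hc, ← inv_pow, one_div, inv_inv, ENNReal.ofReal_pow (by norm_num),
      ENNReal.ofReal_ofNat]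
  have hroot (a : ℝ≥0∞) : a ^ (1 / 2 : ℝ≥0∞).toReal * a ^ (1 / 2 : ℝ≥0∞).toReal = a := by
    rw [← ENNReal.rpow_add_of_nonneg _ _ (by positivity) (by positivity)]
    norm_num
  calc eLpNorm (instantaneousCorr f g t) 1 ρ
      ≤ eLpNorm (fun s ↦ f (t + (1 / 2 : ℝ) • s)) 2 ρ
          * eLpNorm (fun s ↦ g (t + (-(1 / 2) : ℝ) • s)) 2 ρ := by
        have hHolder := eLpNorm_smul_le_mul_eLpNorm (p := 2) (q := 2) (r := 1)
          (memLp_comp_add_smul hg t hneg).star.1 (memLp_comp_add_smul hf t hhalf).1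
        rw [eLpNorm_star] at hHolder
        rw [funext (instantaneousCorr_eq_mul_star f g t)]
        exact hHolder
    _ = 2 ^ Module.finrank ℝ E * (eLpNorm f 2 ρ * eLpNorm g 2 ρ) := by
        rw [eLpNorm_comp_add_smul f 2 t hhalf, eLpNorm_comp_add_smul g 2 t hneg,
          hscale (by norm_num), hscale (by norm_num), mul_mul_mul_comm, hroot]

theorem aestronglyMeasurable_instantaneousCorr (hf : AEStronglyMeasurable f ρ)
    (hg : AEStronglyMeasurable g ρ) :
    AEStronglyMeasurable (fun z : E × E ↦ instantaneousCorr f g z.1 z.2) (ρ.prod ρ) := by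
  simp only [instantaneousCorr_eq_mul_star]
  exact (hf.comp_quasiMeasurePreserving (quasiMeasurePreserving_add_smul ρ (1 / 2))).mul
    (hg.comp_quasiMeasurePreserving (quasiMeasurePreserving_add_smul ρ (-(1 / 2)))).star

theorem lintegral_lintegral_enorm_sq_instantaneousCorr [NormMulClass R]
    (hf : AEStronglyMeasurable f ρ) (hg : AEStronglyMeasurable g ρ) :
    ∫⁻ t, ∫⁻ s, ‖instantaneousCorr f g t s‖ₑ ^ 2 ∂ρ ∂ρ
      = (eLpNorm f 2 ρ * eLpNorm g 2 ρ) ^ 2 := by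
  have hstar (q : R) : ‖star q‖ₑ = ‖q‖ₑ := enorm_eq_iff_norm_eq.2 (norm_star q)
  have hshift (s : E) : ∫⁻ t, ‖instantaneousCorr f g t s‖ₑ ^ 2 ∂ρ
      = ∫⁻ t, ‖f t‖ₑ ^ 2 * ‖g (t - s)‖ₑ ^ 2 ∂ρ := by
    rw [← lintegral_add_right_eq_self (fun t ↦ ‖f t‖ₑ ^ 2 * ‖g (t - s)‖ₑ ^ 2) ((1 / 2 : ℝ) • s)]
    refine lintegral_congr fun t ↦ ?_
    rw [instantaneousCorr, enorm_mul, mul_pow, hstar,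
      show t + (1 / 2 : ℝ) • s - s = t - (1 / 2 : ℝ) • s by module]
  have hmeas : AEMeasurable (fun z : E × E ↦ ‖f z.2‖ₑ ^ 2 * ‖g (z.2 - z.1)‖ₑ ^ 2)
      (ρ.prod ρ) := by
    have hsub : Measure.QuasiMeasurePreserving (fun z : E × E ↦ z.2 - z.1) (ρ.prod ρ) ρ :=
      (quasiMeasurePreserving_sub ρ ρ).comp Measure.measurePreserving_swap.quasiMeasurePreserving
    exact (hf.comp_snd.enorm.pow_const 2).mul
      ((hg.comp_quasiMeasurePreserving hsub).enorm.pow_const 2)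
  calc ∫⁻ t, ∫⁻ s, ‖instantaneousCorr f g t s‖ₑ ^ 2 ∂ρ ∂ρ
      = ∫⁻ s, ∫⁻ t, ‖f t‖ₑ ^ 2 * ‖g (t - s)‖ₑ ^ 2 ∂ρ ∂ρ := by
        rw [lintegral_lintegral_swap
          ((aestronglyMeasurable_instantaneousCorr hf hg).enorm.pow_const 2)]
        simp only [hshift]
    _ = ∫⁻ t, ‖f t‖ₑ ^ 2 * ∫⁻ s, ‖g (t - s)‖ₑ ^ 2 ∂ρ ∂ρ := by
        rw [lintegral_lintegral_swap hmeas]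
        exact lintegral_congr fun t ↦ lintegral_const_mul' _ _ (by finiteness)
    _ = (eLpNorm f 2 ρ * eLpNorm g 2 ρ) ^ 2 := by
        simp only [lintegral_sub_left_eq_self (fun x ↦ ‖g x‖ₑ ^ 2)]
        rw [lintegral_mul_const'' _ (hf.enorm.pow_const 2), mul_pow, eLpNorm_two_sq_eq_lintegral,
          eLpNorm_two_sq_eq_lintegral]

end InstantaneousCorrelation

section WignerVille

variable {lam mu : ℍ[ℝ]} {A₁ A₂ : OffsetMatrix} {f g : ℝ × ℝ → ℍ[ℝ]}

theorem wvdQOLCT_eq_twoSidedQOLCT (lam mu : ℍ[ℝ]) (A₁ A₂ : OffsetMatrix) (f g : ℝ × ℝ → ℍ[ℝ])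
    (t u : ℝ × ℝ) :
    wvdQOLCT lam mu A₁ A₂ f g t u
      = twoSidedQOLCT lam mu A₁ A₂ (instantaneousCorr f g t) u := rfl

theorem quatL2Norm_nonneg (f : ℝ × ℝ → ℍ[ℝ]) : 0 ≤ quatL2Norm f := Real.sqrt_nonneg _

theorem ofReal_quatL2Norm (hf : MemLp f 2) :
    ENNReal.ofReal (quatL2Norm f) = eLpNorm f 2 volume := by
  rw [hf.eLpNorm_eq_integral_rpow_norm two_ne_zero ENNReal.ofNat_ne_top, quatL2Norm,
    Real.sqrt_eq_rpow]
  simp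

theorem integrable_wvdIntegrand (hlam : lam ^ 2 = -1) (hmu : mu ^ 2 = -1)
    (hf : MemLp f 2) (hg : MemLp g 2) (t u : ℝ × ℝ) :
    Integrable (wvdIntegrand lam mu A₁ A₂ f g t u) :=
  integrable_twoSidedQOLCT_integrand hlam hmu (integrable_instantaneousCorr hf hg t) u

theorem aestronglyMeasurable_wvdQOLCT (lam mu : ℍ[ℝ]) (A₁ A₂ : OffsetMatrix)
    (hf : AEStronglyMeasurable f) (hg : AEStronglyMeasurable g) :
    AEStronglyMeasurable (fun z : (ℝ × ℝ) × (ℝ × ℝ) ↦ wvdQOLCT lam mu A₁ A₂ f g z.1 z.2) := by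
  have hcorr := aestronglyMeasurable_instantaneousCorr hf hg
  simp only [wvdQOLCT_eq_twoSidedQOLCT]
  exact aestronglyMeasurable_twoSidedQOLCT (X := ℝ × ℝ) (ρ := volume) lam mu A₁ A₂
    (k := instantaneousCorr f g) hcorr

theorem norm_wvdQOLCT_le (hlam : lam ^ 2 = -1) (hmu : mu ^ 2 = -1)
    (hf : MemLp f 2) (hg : MemLp g 2) (t u : ℝ × ℝ) :
    ‖wvdQOLCT lam mu A₁ A₂ f g t u‖
      ≤ 1 / (2 * Real.pi * √|A₁.b * A₂.b|) * (4 * (quatL2Norm f * quatL2Norm g)) := by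
  have hcorr : ∫ s, ‖instantaneousCorr f g t s‖ ≤ 4 * (quatL2Norm f * quatL2Norm g) := by
    have hN : 0 ≤ quatL2Norm f * quatL2Norm g :=
      mul_nonneg (quatL2Norm_nonneg f) (quatL2Norm_nonneg g)
    rw [← ENNReal.ofReal_le_ofReal_iff (by positivity),
      ofReal_integral_norm_eq_lintegral_enorm (integrable_instantaneousCorr hf hg t),
      ← eLpNorm_one_eq_lintegral_enorm, ENNReal.ofReal_mul (by norm_num),
      ENNReal.ofReal_mul (quatL2Norm_nonneg f), ofReal_quatL2Norm hf, ofReal_quatL2Norm hg]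
    refine (eLpNorm_one_instantaneousCorr_le hf hg t).trans_eq ?_
    rw [Module.finrank_prod, Module.finrank_self, ENNReal.ofReal_ofNat]
    norm_num
  rw [wvdQOLCT_eq_twoSidedQOLCT]
  exact (norm_twoSidedQOLCT_le hlam hmu _ u).trans
    (mul_le_mul_of_nonneg_left hcorr (by positivity))

theorem lintegral_enorm_sq_wvdQOLCT (hlam : lam ^ 2 = -1) (hmu : mu ^ 2 = -1)
    (h₁ : A₁.b ≠ 0) (h₂ : A₂.b ≠ 0) (hf : MemLp f 2) (hg : MemLp g 2) :
    ∫⁻ z : (ℝ × ℝ) × (ℝ × ℝ), ‖wvdQOLCT lam mu A₁ A₂ f g z.1 z.2‖ₑ ^ 2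
      = (eLpNorm f 2 volume * eLpNorm g 2 volume) ^ 2 := by
  have hcorr := lintegral_lintegral_enorm_sq_instantaneousCorr hf.1 hg.1
  have hfin : ∀ᵐ t : ℝ × ℝ, ∫⁻ s, ‖instantaneousCorr f g t s‖ₑ ^ 2 < ⊤ := by
    refine ae_lt_top' ?_ (hcorr.trans_ne ?_)
    · have hmeas := aestronglyMeasurable_instantaneousCorr hf.1 hg.1
      exact (hmeas.enorm.pow_const 2).lintegral_prod_right'
    · exact ENNReal.pow_ne_top (ENNReal.mul_ne_top hf.eLpNorm_ne_top hg.eLpNorm_ne_top)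
  rw [← hcorr, Measure.volume_eq_prod, lintegral_prod _
    ((aestronglyMeasurable_wvdQOLCT lam mu A₁ A₂ hf.1 hg.1).enorm.pow_const 2)]
  refine lintegral_congr_ae ?_
  filter_upwards [hfin] with t ht
  have hint := integrable_instantaneousCorr hf hg t
  exact lintegral_enorm_sq_twoSidedQOLCT hlam hmu h₁ h₂ hint
    (memLp_two_of_lintegral_lt_top hint.1 ht)

theorem integrable_norm_sq_wvdQOLCT (hlam : lam ^ 2 = -1) (hmu : mu ^ 2 = -1)
    (h₁ : A₁.b ≠ 0) (h₂ : A₂.b ≠ 0) (hf : MemLp f 2) (hg : MemLp g 2) :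
    Integrable (fun z : (ℝ × ℝ) × (ℝ × ℝ) ↦ ‖wvdQOLCT lam mu A₁ A₂ f g z.1 z.2‖ ^ 2) := by
  refine (memLp_two_of_lintegral_lt_top
    (aestronglyMeasurable_wvdQOLCT lam mu A₁ A₂ hf.1 hg.1) ?_).integrable_norm_pow two_ne_zero
  rw [lintegral_enorm_sq_wvdQOLCT hlam hmu h₁ h₂ hf hg]
  exact ENNReal.pow_lt_top (ENNReal.mul_lt_top hf.2 hg.2)

theorem integral_norm_sq_wvdQOLCT (hlam : lam ^ 2 = -1) (hmu : mu ^ 2 = -1)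
    (h₁ : A₁.b ≠ 0) (h₂ : A₂.b ≠ 0) (hf : MemLp f 2) (hg : MemLp g 2) :
    ∫ z : (ℝ × ℝ) × (ℝ × ℝ), ‖wvdQOLCT lam mu A₁ A₂ f g z.1 z.2‖ ^ 2
      = (quatL2Norm f * quatL2Norm g) ^ 2 := by
  have hN : 0 ≤ quatL2Norm f * quatL2Norm g :=
    mul_nonneg (quatL2Norm_nonneg f) (quatL2Norm_nonneg g)
  rw [← ENNReal.ofReal_eq_ofReal_iff (by positivity) (by positivity),
    ofReal_integral_eq_lintegral_ofReal (integrable_norm_sq_wvdQOLCT hlam hmu h₁ h₂ hf hg)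
      (.of_forall fun _ ↦ by positivity), ENNReal.ofReal_pow hN,
    ENNReal.ofReal_mul (quatL2Norm_nonneg f), ofReal_quatL2Norm hf, ofReal_quatL2Norm hg,
    ← lintegral_enorm_sq_wvdQOLCT hlam hmu h₁ h₂ hf hg]
  simp only [ENNReal.ofReal_pow (norm_nonneg _), ofReal_norm]

end WignerVille

section Interpolation

variable {α F : Type*} {m : MeasurableSpace α} {ρ : Measure α} [NormedAddCommGroup F] {h : α → F}
  {M p q : ℝ}

theorem rpow_le_rpow_sub_mul_rpow {x : ℝ} (hq : 0 ≤ q) (hqp : q ≤ p) (hx : 0 ≤ x) (hxM : x ≤ M) :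
    x ^ p ≤ M ^ (p - q) * x ^ q := by
  rw [← sub_add_cancel p q, Real.rpow_add_of_nonneg hx (sub_nonneg.2 hqp) hq, add_sub_cancel_right]
  gcongr

theorem integrable_norm_rpow_of_norm_le (hq : 0 ≤ q) (hqp : q ≤ p) (hh : AEStronglyMeasurable h ρ)
    (hint : Integrable (fun x ↦ ‖h x‖ ^ q) ρ) (hM : ∀ᵐ x ∂ρ, ‖h x‖ ≤ M) :
    Integrable (fun x ↦ ‖h x‖ ^ p) ρ := by
  refine (hint.const_mul (M ^ (p - q))).mono'
    ((Real.continuous_rpow_const (hq.trans hqp)).comp_aestronglyMeasurable hh.norm) ?_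
  filter_upwards [hM] with x hx
  rw [Real.norm_of_nonneg (by positivity)]
  exact rpow_le_rpow_sub_mul_rpow hq hqp (norm_nonneg _) hx

theorem integral_norm_rpow_le_of_norm_le (hq : 0 ≤ q) (hqp : q ≤ p)
    (hint : Integrable (fun x ↦ ‖h x‖ ^ q) ρ) (hM : ∀ᵐ x ∂ρ, ‖h x‖ ≤ M) :
    ∫ x, ‖h x‖ ^ p ∂ρ ≤ M ^ (p - q) * ∫ x, ‖h x‖ ^ q ∂ρ := by
  rw [← integral_const_mul]
  refine integral_mono_of_nonneg (.of_forall fun x ↦ by positivity) (hint.const_mul _) ?_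
  filter_upwards [hM] with x hx
  exact rpow_le_rpow_sub_mul_rpow hq hqp (norm_nonneg _) hx

end Interpolation

theorem lieb_constant_eq {p B N : ℝ} (hp : 2 ≤ p) (hB : 0 < B) (hN : 0 ≤ N) :
    (1 / (2 * Real.pi * √B) * (4 * N)) ^ (p - 2) * N ^ 2
      = 4 ^ (p - 2) * (2 * Real.pi) ^ 2 * (B ^ (-p / 2 + 1) / (2 * Real.pi) ^ p) * N ^ p := by
  have hpi : 0 < 2 * Real.pi := by positivity
  have hNp : N ^ p = N ^ (p - 2) * N ^ 2 := by
    rw [← Real.rpow_two, ← Real.rpow_add_of_nonneg hN (by linarith) zero_le_two, sub_add_cancel]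
  have hBp : B ^ (-p / 2 + 1) = (√B ^ (p - 2))⁻¹ := by
    rw [Real.sqrt_eq_rpow, ← Real.rpow_mul hB.le, ← Real.rpow_neg hB.le]
    congr 1
    ring
  have hpip : (2 * Real.pi) ^ p = (2 * Real.pi) ^ (p - 2) * (2 * Real.pi) ^ 2 := by
    rw [← Real.rpow_two (2 * Real.pi), ← Real.rpow_add hpi, sub_add_cancel]
  rw [hNp, hBp, hpip, Real.mul_rpow (by positivity) (by positivity),
    Real.mul_rpow (by norm_num) hN, Real.div_rpow zero_le_one (by positivity), Real.one_rpow,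
    Real.mul_rpow hpi.le (Real.sqrt_nonneg B)]
  field_simp

theorem mainTheorem4 (p : ℝ) (hp : 2 ≤ p) :
    ∃ C : ℝ, 0 < C ∧
      ∀ (lam mu : ℍ[ℝ]), lam ^ 2 = -1 → mu ^ 2 = -1 →
      ∀ (A₁ A₂ : OffsetMatrix), A₁.b ≠ 0 → A₂.b ≠ 0 →
      ∀ (f g : ℝ × ℝ → ℍ[ℝ]), MemLp f 2 volume → MemLp g 2 volume →
        (∀ t u : ℝ × ℝ, Integrable (wvdIntegrand lam mu A₁ A₂ f g t u) volume) ∧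
        Integrable (fun z : (ℝ × ℝ) × (ℝ × ℝ) => ‖wvdQOLCT lam mu A₁ A₂ f g z.1 z.2‖ ^ p) volume ∧
        ∫ t : ℝ × ℝ, ∫ u : ℝ × ℝ, ‖wvdQOLCT lam mu A₁ A₂ f g t u‖ ^ p
          ≤ C * (|A₁.b * A₂.b| ^ (-p / 2 + 1) / (2 * Real.pi) ^ p)
              * quatL2Norm f ^ p * quatL2Norm g ^ p := by
  refine ⟨4 ^ (p - 2) * (2 * Real.pi) ^ 2, by positivity,
    fun lam mu hlam hmu A₁ A₂ h₁ h₂ f g hf hg ↦ ?_⟩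
  have hN := mul_nonneg (quatL2Norm_nonneg f) (quatL2Norm_nonneg g)
  have hB : 0 < |A₁.b * A₂.b| := abs_pos.2 (mul_ne_zero h₁ h₂)
  have hsq := integrable_norm_sq_wvdQOLCT hlam hmu h₁ h₂ hf hg
  simp only [← Real.rpow_two] at hsq
  have hsup := Filter.Eventually.of_forall (f := ae volume) fun z : (ℝ × ℝ) × (ℝ × ℝ) ↦
    norm_wvdQOLCT_le (A₁ := A₁) (A₂ := A₂) hlam hmu hf hg z.1 z.2
  have hint := integrable_norm_rpow_of_norm_le zero_le_two hp
    (aestronglyMeasurable_wvdQOLCT lam mu A₁ A₂ hf.1 hg.1) hsq hsup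
  refine ⟨integrable_wvdIntegrand hlam hmu hf hg, hint, ?_⟩
  rw [integral_integral hint, mul_assoc _ (quatL2Norm f ^ p),
    ← Real.mul_rpow (quatL2Norm_nonneg f) (quatL2Norm_nonneg g), ← lieb_constant_eq hp hB hN]
  refine (integral_norm_rpow_le_of_norm_le zero_le_two hp hsq hsup).trans_eq ?_
  simp only [Real.rpow_two, integral_norm_sq_wvdQOLCT hlam hmu h₁ h₂ hf hg]
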